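/- Graphs are finite and loopless, and may have multiple edges; $k$ is a positive integer. For a graph $G$, let $\omega(G)$ be its number of connected components. An edge-cut of $G$ is an inclusion-minimal set $X\subseteq E(G)$ such that $G-X$ is disconnected; the edge connectivity $\kappa'(G)$ is the minimum size of an edge-cut of $G$. Let $\tau(G)$ be the maximum number of pairwise edge-disjoint spanning trees of $G$. The density of $G$ is $$d(G)=\frac{|E(G)|}{|V(G)|-\omega(G)}$$ (defined when $|V(G)|\ne\omega(G)$, i.e. when $E(G)\neq\emptyset$), and $\gamma(G)=\max d(H)$, the maximum being over all subgraphs $H$ of $G$ with $|V(H)|\neq\omega(H)$. $G$ is uniformly dense if $d(G)=\gamma(G)$. For $n>1$ let $\mathcal F_{k,n}$ be the set of graphs $G$ with $|V(G)|=n$ and $\kappa'(G)=\tau(G)=k$ that have the minimum number of edges among all graphs with these properties, and let $\mathcal F_k=\bigcup_{n>1}\mathcal F_{k,n}$. Theorem. Let $G$ be a graph. Then $G\in\mathcal F_k$ if and only if both of the following hold: (i) $G$ has an edge-cut of size $k$; (ii) $G$ is uniformly dense with density $k$, i.e. $d(G)=\gamma(G)=k$. -/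

import Mathlib

open scoped Graph

universe u v

noncomputable section

namespace Multigraph

/-- The standing convention on graphs: finitely many vertices and edges, parallel edges allowed,
no loops. -/
structure IsFiniteLoopless {α : Type u} {β : Type v} (G : Graph α β) : Prop where
  finite_vertexSet : V(G).Finite
  finite_edgeSet : E(G).Finite
  loopless : G.Loopless

/-- The number `ω(G)` of connected components. -/
def numComponents {α : Type u} {β : Type v} (G : Graph α β) : ℕ :=
  Nat.card G.toSimpleGraph.ConnectedComponent

/-- An edge-cut is an inclusion-minimal set of edges whose deletion leaves a disconnected graph. -/
def IsEdgeCut {α : Type u} {β : Type v} (G : Graph α β) (X : Set β) : Prop :=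
  Minimal (fun Y : Set β => Y ⊆ E(G) ∧ 1 < numComponents (G.deleteEdges Y)) X

/-- The edge connectivity `κ'(G)`: the minimum size of an edge-cut. It is `⊤` when there is no
edge-cut, which for finite graphs means at most one vertex. -/
def edgeConnectivity {α : Type u} {β : Type v} (G : Graph α β) : ℕ∞ :=
  ⨅ (X : Set β) (_ : IsEdgeCut G X), X.encard

/-- `T` is a spanning tree of `G`: a spanning subgraph without loops or parallel edges whose
underlying simple graph is a tree. -/
structure IsSpanningTree {α : Type u} {β : Type v} (T G : Graph α β) : Prop where
  spanning : T ≤s G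
  simple : T.Simple
  isTree : T.toSimpleGraph.IsTree

/-- `G` has `m` pairwise edge-disjoint spanning trees. -/
def HasDisjointSpanningTrees {α : Type u} {β : Type v} (G : Graph α β) (m : ℕ) : Prop :=
  ∃ T : Fin m → Graph α β, (∀ i, IsSpanningTree (T i) G) ∧
    Pairwise fun i j => Disjoint E(T i) E(T j)

/-- `τ(G)`: the maximum number of edge-disjoint spanning trees (`⊤` for the one-vertex graph). -/
def treePackingNumber {α : Type u} {β : Type v} (G : Graph α β) : ℕ∞ :=
  ⨆ (m : ℕ) (_ : HasDisjointSpanningTrees G m), (m : ℕ∞)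

/-- The density `d(G) = |E(G)| / (|V(G)| - ω(G))`. -/
def density {α : Type u} {β : Type v} (G : Graph α β) : ℝ :=
  (E(G).ncard : ℝ) / ((V(G).ncard : ℝ) - (numComponents G : ℝ))

/-- `γ(G)`: the maximum of `d(H)` over the subgraphs `H` of `G` for which the denominator of
`d(H)` is nonzero. -/
def maxSubgraphDensity {α : Type u} {β : Type v} (G : Graph α β) : ℝ :=
  sSup {q : ℝ | ∃ H : Graph α β, H ≤ G ∧ (V(H).ncard : ℝ) - (numComponents H : ℝ) ≠ 0 ∧
    q = density H}

/-- `G` is uniformly dense: `d(G) = γ(G)`. -/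
def IsUniformlyDense {α : Type u} {β : Type v} (G : Graph α β) : Prop :=
  density G = maxSubgraphDensity G

/-- The family `F_{k,n}`: the graphs `G` on `n` vertices with `κ'(G) = τ(G) = k` that have the
minimum number of edges among all such graphs (on arbitrary vertex and edge types). -/
structure MemFamilyOfOrder {α : Type u} {β : Type v} (k n : ℕ) (G : Graph α β) : Prop where
  isFiniteLoopless : IsFiniteLoopless G
  card_vertexSet : V(G).ncard = n
  edgeConnectivity_eq : edgeConnectivity G = k
  treePackingNumber_eq : treePackingNumber G = k
  minimal : ∀ (α' : Type u) (β' : Type v) (H : Graph α' β'), IsFiniteLoopless H →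
    V(H).ncard = n → edgeConnectivity H = k → treePackingNumber H = k →
    E(G).ncard ≤ E(H).ncard

/-- The family `F_k`, the union of the families `F_{k,n}` over `n > 1`. -/
def MemFamily {α : Type u} {β : Type v} (k : ℕ) (G : Graph α β) : Prop :=
  ∃ n : ℕ, 1 < n ∧ MemFamilyOfOrder k n G

end Multigraph

end

/-!
Both directions rest on the cycle matroid of `G`. Its rank function `graphicRank` is realised as the
dimension of the span of the differences of the ends of edges, which makes submodularity a fact
about subspaces, and it satisfies `|V(H)| - ω(H) = r(E(H))` for every subgraph `H`
(`numComponents_add_graphicRank`). So the density of `H` is `|E(H)| / r(E(H))`, and spanning trees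
are the independent sets with `|V(G)| - 1` edges.

Suppose `G` is extremal. Since `τ(G) = k`, there are `k` disjoint spanning trees; their union is a
spanning subgraph with the same edge connectivity and the same `τ`, hence it has at least as many
edges as `G`, and the trees exhaust `E(G)` (`MemFamilyOfOrder.ncard_edgeSet`). An arbitrary set `X`
of edges is then covered by `k` independent sets, so `|X| ≤ k r(X)` and no subgraph has density
above `k`.

Conversely, if `G` is uniformly dense with density `k` and has a nonempty edge-cut, then `G` is
connected, has `k (|V(G)| - 1)` edges, and satisfies `|X| ≤ k r(X)` for all `X ⊆ E(G)`. Edmonds'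
covering theorem (`exists_disjoint_independent_cover`) splits `E(G)` into `k` independent sets,
which by counting are spanning trees. Every edge-cut meets each of them, so `κ'(G) ≥ k`, and the
given cut shows equality; the number of edges bounds `τ(G)` by `k`, and is the least possible for a
graph with `k` disjoint spanning trees.

The covering theorem is proved for a family of rank functions by induction on the ground set,
contracting an element in one of them at each step (`exists_contract`).
-/

namespace Multigraph

/-! ### Covering a ground set by independent sets of several matroids -/

/-- `r` has the properties of a matroid rank function on the finite subsets of `β`. The values are
integers, so that contraction is an honest subtraction. -/
structure IsRankFunction {β : Type*} [DecidableEq β] (r : Finset β → ℤ) : Prop where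
  empty : r ∅ = 0
  mono : ∀ ⦃X Y⦄, X ⊆ Y → r X ≤ r Y
  submodular : ∀ X Y, r (X ∪ Y) + r (X ∩ Y) ≤ r X + r Y
  singleton_le : ∀ e, r {e} ≤ 1

namespace IsRankFunction

variable {β : Type*} [DecidableEq β] {r : Finset β → ℤ}

lemma insert_le (hr : IsRankFunction r) (e : β) (X : Finset β) : r (insert e X) ≤ r X + 1 := by
  have h := hr.submodular {e} X
  have h1 := hr.singleton_le e
  have h2 := hr.mono (Finset.empty_subset ({e} ∩ X))
  rw [hr.empty] at h2
  rw [Finset.insert_eq]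
  linarith

/-- If `e` lies in the closure of `X`, then it lies in the closure of every larger set. -/
lemma insert_eq_of_subset (hr : IsRankFunction r) {e : β} {X Y : Finset β} (hXY : X ⊆ Y)
    (h : r (insert e X) = r X) : r (insert e Y) = r Y := by
  refine le_antisymm ?_ (hr.mono (Finset.subset_insert _ _))
  have h1 := hr.submodular (insert e X) Y
  have h2 := hr.mono (Finset.subset_inter (Finset.subset_insert e X) hXY)
  have h3 : insert e X ∪ Y = insert e Y := by
    rw [Finset.insert_union, Finset.union_eq_right.2 hXY]
  rw [h3] at h1
  linarith

/-- The contraction of a rank function by a non-loop. -/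
lemma contract (hr : IsRankFunction r) {e : β} (he : r {e} = 1) :
    IsRankFunction fun X => r (insert e X) - 1 where
  empty := by simp [he]
  mono X Y h := by
    have := hr.mono (Finset.insert_subset_insert e h)
    linarith
  submodular X Y := by
    have := hr.submodular (insert e X) (insert e Y)
    rw [← Finset.insert_union_distrib, ← Finset.insert_inter_distrib] at this
    linarith
  singleton_le f := by
    have := hr.insert_le f {e}
    rw [Finset.pair_comm] at this
    linarith

end IsRankFunction

section Covering

variable {β ι : Type*} [DecidableEq β] [Fintype ι]

/-- A union of tight sets is tight: the tight sets are the zeros of the nonnegative submodular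
function `∑ i, r i X - |X|`. -/
lemma biUnion_tight {r : ι → Finset β → ℤ} (hr : ∀ i, IsRankFunction (r i)) {E : Finset β}
    (hE : ∀ X ⊆ E, (X.card : ℤ) ≤ ∑ i, r i X) (s : Finset ι) (X : ι → Finset β)
    (hXE : ∀ i, X i ⊆ E) (hX : ∀ i, ∑ j, r j (X i) = (X i).card) :
    ∑ j, r j (s.biUnion X) = (s.biUnion X).card := by
  classical
  induction s using Finset.induction_on with
  | empty => simp [(hr _).empty]
  | insert a s ha ih =>
    rw [Finset.biUnion_insert]
    have hs : s.biUnion X ⊆ E := Finset.biUnion_subset.2 fun i _ => hXE i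
    have h1 := hE _ (Finset.union_subset (hXE a) hs)
    have h2 := hE _ (Finset.inter_subset_left.trans (hXE a) : X a ∩ s.biUnion X ⊆ E)
    have h3 : ∑ j, (r j (X a ∪ s.biUnion X) + r j (X a ∩ s.biUnion X)) ≤
        ∑ j, (r j (X a) + r j (s.biUnion X)) :=
      Finset.sum_le_sum fun j _ => (hr j).submodular _ _
    have h4 := Finset.card_union_add_card_inter (X a) (s.biUnion X)
    have h5 := hX a
    rw [Finset.sum_add_distrib, Finset.sum_add_distrib] at h3
    zify at h4
    linarith

/-- The inductive step of the covering theorem: under the rank condition, `e` can be assigned to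
one of the rank functions so that the rank condition survives the contraction of that function by
`e`. Otherwise each `i` has a tight set whose `i`-th closure contains `e`; the union `U` of these
sets is tight, and `U ∪ {e}` violates the rank condition. -/
lemma exists_contract [DecidableEq ι] {r : ι → Finset β → ℤ} (hr : ∀ i, IsRankFunction (r i))
    {E : Finset β} {e : β} (he : e ∉ E)
    (hE : ∀ X ⊆ insert e E, (X.card : ℤ) ≤ ∑ i, r i X) :
    ∃ i, r i {e} = 1 ∧ ∀ X ⊆ E, (X.card : ℤ) ≤
      ∑ j, Function.update r i (fun X => r i (insert e X) - 1) j X := by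
  by_contra! hcon
  have hE' : ∀ X ⊆ E, (X.card : ℤ) ≤ ∑ i, r i X := fun X hX =>
    hE X (hX.trans (Finset.subset_insert _ _))
  have key : ∀ i, ∃ X ⊆ E, ∑ j, r j X = X.card ∧ r i (insert e X) = r i X := by
    intro i
    by_cases h1 : r i {e} = 1
    · obtain ⟨X, hX, hlt⟩ := hcon i h1
      have hsplit := Finset.add_sum_erase Finset.univ (fun j => r j X) (Finset.mem_univ i)
      rw [← Finset.add_sum_erase _ _ (Finset.mem_univ i), Function.update_self,
        Finset.sum_congr rfl fun j hj => by
          rw [Function.update_of_ne (Finset.ne_of_mem_erase hj)]] at hlt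
      have h2 := hE' X hX
      have h3 := (hr i).mono (Finset.subset_insert e X)
      refine ⟨X, hX, ?_, ?_⟩ <;> linarith
    · refine ⟨∅, Finset.empty_subset _, by simp [(hr _).empty], ?_⟩
      have h2 := (hr i).singleton_le e
      have h3 := (hr i).mono (Finset.empty_subset {e})
      rw [(hr i).empty] at h3
      rw [insert_empty_eq, (hr i).empty]
      omega
  choose X hXE hXt hXe using key
  set U := Finset.univ.biUnion X with hU
  have hUE : U ⊆ E := Finset.biUnion_subset.2 fun i _ => hXE i
  have h1 : ∑ j, r j U = U.card := biUnion_tight hr hE' _ X hXE hXt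
  have h2 : ∑ j, r j (insert e U) = ∑ j, r j U := Finset.sum_congr rfl fun j _ =>
    (hr j).insert_eq_of_subset (Finset.subset_biUnion_of_mem X (Finset.mem_univ j)) (hXe j)
  have h3 := hE _ (Finset.insert_subset_insert e hUE)
  rw [Finset.card_insert_of_notMem fun h => he (hUE h), h2, h1] at h3
  push_cast at h3
  linarith

/-- Edmonds' covering theorem for finitely many matroids: if `|X| ≤ ∑ i, r i X` for all `X ⊆ E`,
then `E` is a disjoint union of sets `I i`, with `I i` independent for `r i`. -/
theorem exists_disjoint_independent_cover (r : ι → Finset β → ℤ)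
    (hr : ∀ i, IsRankFunction (r i)) (E : Finset β)
    (hE : ∀ X ⊆ E, (X.card : ℤ) ≤ ∑ i, r i X) :
    ∃ I : ι → Finset β, Pairwise (fun i j => Disjoint (I i) (I j)) ∧
      Finset.univ.biUnion I = E ∧ ∀ i, r i (I i) = (I i).card := by
  classical
  induction E using Finset.induction_on generalizing r with
  | empty => exact ⟨fun _ => ∅, fun _ _ _ => by simp, by ext; simp, fun i => by simp [(hr i).empty]⟩
  | insert e E he ih =>
    obtain ⟨i, hi, hi'⟩ := exists_contract hr he hE
    obtain ⟨I, hd, hc, hI⟩ := ih _ (fun j => by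
      obtain rfl | hj := eq_or_ne j i
      · rw [Function.update_self]; exact (hr j).contract hi
      · rw [Function.update_of_ne hj]; exact hr j) hi'
    have hsub : ∀ j, I j ⊆ E := fun j => hc ▸ Finset.subset_biUnion_of_mem I (Finset.mem_univ j)
    have heI : ∀ j, e ∉ I j := fun j h => he (hsub j h)
    refine ⟨Function.update I i (insert e (I i)), ?_, ?_, ?_⟩
    · intro a b hab
      have := hd hab
      obtain rfl | ha := eq_or_ne a i
      · rw [Function.update_self, Function.update_of_ne hab.symm, Finset.disjoint_insert_left]
        exact ⟨heI b, this⟩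
      · obtain rfl | hb := eq_or_ne b i
        · rw [Function.update_self, Function.update_of_ne ha, Finset.disjoint_insert_right]
          exact ⟨heI a, this⟩
        · rwa [Function.update_of_ne ha, Function.update_of_ne hb]
    · rw [← hc]
      ext x
      simp only [Finset.mem_biUnion, Finset.mem_univ, true_and, Finset.mem_insert]
      constructor
      · rintro ⟨j, hj⟩
        obtain rfl | hji := eq_or_ne j i
        · rw [Function.update_self, Finset.mem_insert] at hj
          exact hj.imp_right fun h => ⟨j, h⟩
        · rw [Function.update_of_ne hji] at hj
          exact Or.inr ⟨j, hj⟩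
      · rintro (rfl | ⟨j, hj⟩)
        · exact ⟨i, by simp⟩
        · refine ⟨j, ?_⟩
          obtain rfl | hji := eq_or_ne j i
          · rw [Function.update_self]; exact Finset.mem_insert_of_mem hj
          · rwa [Function.update_of_ne hji]
    · intro j
      have := hI j
      obtain rfl | hji := eq_or_ne j i
      · rw [Function.update_self] at this ⊢
        rw [Finset.card_insert_of_notMem (heI j)]
        push_cast
        linarith
      · rw [Function.update_of_ne hji] at this ⊢
        exact this

end Covering
/-! ### The rank function of the cycle matroid -/

section Rank

variable {α : Type u} {β : Type v} {G H : Graph α β} {X Y : Set β}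

/-- The span, in the free vector space on all of `α`, of the differences of the two ends of the
edges in `X`. As the space does not depend on `V(G)`, passing to a subgraph does not change it. -/
noncomputable def boundarySpan (G : Graph α β) (X : Set β) : Submodule ℚ (α →₀ ℚ) :=
  Submodule.span ℚ {x | ∃ e ∈ X, ∃ u v, G.IsLink e u v ∧
    x = Finsupp.single u 1 - Finsupp.single v 1}

/-- The rank of a set of edges in the cycle matroid of `G`. -/
noncomputable def graphicRank (G : Graph α β) (X : Set β) : ℕ :=
  Module.finrank ℚ (boundarySpan G X)

lemma boundarySpan_mono (G : Graph α β) (h : X ⊆ Y) : boundarySpan G X ≤ boundarySpan G Y :=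
  Submodule.span_mono fun _ ⟨e, he, h'⟩ => ⟨e, h he, h'⟩

@[simp] lemma boundarySpan_empty (G : Graph α β) : boundarySpan G ∅ = ⊥ :=
  Submodule.span_eq_bot.2 fun _ ⟨_, he, _⟩ => he.elim

lemma boundarySpan_union (G : Graph α β) (X Y : Set β) :
    boundarySpan G (X ∪ Y) = boundarySpan G X ⊔ boundarySpan G Y := by
  rw [boundarySpan, boundarySpan, boundarySpan, ← Submodule.span_union]
  congr 1
  ext x
  simp only [Set.mem_union, Set.mem_ofPred_eq]
  grind

lemma boundarySpan_singleton_le {e : β} {u v : α} (h : G.IsLink e u v) :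
    boundarySpan G {e} ≤ Submodule.span ℚ {Finsupp.single u 1 - Finsupp.single v 1} := by
  refine Submodule.span_le.2 ?_
  rintro _ ⟨_, rfl, a, b, hab, rfl⟩
  obtain ⟨rfl, rfl⟩ | ⟨rfl, rfl⟩ := h.eq_and_eq_or_eq_and_eq hab
  · exact Submodule.mem_span_singleton_self _
  · exact Submodule.mem_span_singleton.2 ⟨-1, by simp⟩

lemma boundarySpan_eq_of_le (hHG : H ≤ G) (hX : X ⊆ E(H)) :
    boundarySpan H X = boundarySpan G X := by
  unfold boundarySpan
  congr 1
  ext x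
  constructor
  · rintro ⟨e, he, u, v, h, rfl⟩
    exact ⟨e, he, u, v, h.mono hHG, rfl⟩
  · rintro ⟨e, he, u, v, h, rfl⟩
    exact ⟨e, he, u, v, (hHG.isLink_iff (hX he)).2 h, rfl⟩

lemma graphicRank_eq_of_le (hHG : H ≤ G) (hX : X ⊆ E(H)) : graphicRank H X = graphicRank G X := by
  rw [graphicRank, boundarySpan_eq_of_le hHG hX, graphicRank]

lemma finiteDimensional_boundarySpan (hV : V(G).Finite) (X : Set β) :
    FiniteDimensional ℚ (boundarySpan G X) := by
  refine FiniteDimensional.span_of_finite ℚ ((hV.image2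
    (fun u v => Finsupp.single u (1 : ℚ) - Finsupp.single v 1) hV).subset ?_)
  rintro _ ⟨e, -, u, v, h, rfl⟩
  exact ⟨u, h.left_mem, v, h.right_mem, rfl⟩

lemma graphicRank_mono (hV : V(G).Finite) (h : X ⊆ Y) : graphicRank G X ≤ graphicRank G Y :=
  have := finiteDimensional_boundarySpan hV Y
  Submodule.finrank_mono (boundarySpan_mono G h)

lemma graphicRank_submodular (hV : V(G).Finite) (X Y : Set β) :
    graphicRank G (X ∪ Y) + graphicRank G (X ∩ Y) ≤ graphicRank G X + graphicRank G Y := by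
  have := finiteDimensional_boundarySpan hV X
  have := finiteDimensional_boundarySpan hV Y
  unfold graphicRank
  rw [← Submodule.finrank_sup_add_finrank_inf_eq (boundarySpan G X), boundarySpan_union]
  refine Nat.add_le_add_left (Submodule.finrank_mono (le_inf (boundarySpan_mono G Set.inter_subset_left)
    (boundarySpan_mono G Set.inter_subset_right))) _

@[simp] lemma graphicRank_empty (G : Graph α β) : graphicRank G ∅ = 0 := by
  rw [graphicRank, boundarySpan_empty, finrank_bot]

lemma graphicRank_singleton_le (G : Graph α β) (e : β) : graphicRank G {e} ≤ 1 := by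
  by_cases he : e ∈ E(G)
  · obtain ⟨u, v, h⟩ := G.exists_isLink_of_mem_edgeSet he
    exact (Submodule.finrank_mono (boundarySpan_singleton_le h)).trans
      ((finrank_span_le_card _).trans (by simp))
  · have : boundarySpan G {e} = ⊥ := by
      refine Submodule.span_eq_bot.2 ?_
      rintro _ ⟨_, rfl, a, b, hab, rfl⟩
      exact absurd hab.edge_mem he
    rw [graphicRank, this, finrank_bot]
    exact zero_le_one

lemma isRankFunction_graphicRank [DecidableEq β] (hV : V(G).Finite) :
    IsRankFunction fun X : Finset β => (graphicRank G X : ℤ) where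
  empty := by simp
  mono X Y h := by exact_mod_cast graphicRank_mono hV (Finset.coe_subset.2 h)
  submodular X Y := by
    have := graphicRank_submodular hV (X : Set β) Y
    push_cast
    exact_mod_cast this
  singleton_le e := by
    have := graphicRank_singleton_le G e
    push_cast
    exact_mod_cast this

lemma graphicRank_le_ncard (hV : V(G).Finite) (hX : X.Finite) : graphicRank G X ≤ X.ncard := by
  classical
  induction X, hX using Set.Finite.induction_on with
  | empty => simp
  | @insert e S he hS ih =>
    have h := graphicRank_submodular hV {e} S
    have := graphicRank_singleton_le G e
    rw [Set.ncard_insert_of_notMem he hS, Set.insert_eq]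
    omega

/-- Subsets of independent sets are independent. -/
lemma graphicRank_eq_ncard_of_subset (hV : V(G).Finite) (hY : Y.Finite) (hXY : X ⊆ Y)
    (h : graphicRank G Y = Y.ncard) : graphicRank G X = X.ncard := by
  have h1 := graphicRank_submodular hV X (Y \ X)
  have h2 := graphicRank_le_ncard hV (hY.subset hXY)
  have h3 := graphicRank_le_ncard hV (X := Y \ X) hY.sdiff
  have h4 := Set.ncard_sdiff_add_ncard_of_subset hXY hY
  rw [Set.union_sdiff_cancel hXY] at h1
  omega

end Rank

section Components

variable {α : Type u} {β : Type v} {G : Graph α β}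

/-- The difference of two vertices joined by a walk is a sum of differences along edges. -/
lemma single_sub_single_mem_boundarySpan {a b : V(G)} (h : G.toSimpleGraph.Reachable a b) :
    (Finsupp.single (a : α) 1 - Finsupp.single (b : α) 1 : α →₀ ℚ) ∈ boundarySpan G E(G) := by
  obtain ⟨p⟩ := h
  induction p with
  | nil => simp
  | cons h p ih =>
    obtain ⟨-, e, he⟩ := h
    have h1 : (Finsupp.single _ 1 - Finsupp.single _ 1 : α →₀ ℚ) ∈ boundarySpan G E(G) :=
      Submodule.subset_span ⟨e, he.edge_mem, _, _, he, rfl⟩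
    simpa using add_mem h1 ih

/-- The linear map from the free space on the vertices to the free space on the components. -/
noncomputable def componentMap (G : Graph α β) :
    (V(G) →₀ ℚ) →ₗ[ℚ] (G.toSimpleGraph.ConnectedComponent →₀ ℚ) :=
  Finsupp.lmapDomain ℚ ℚ G.toSimpleGraph.connectedComponentMk

/-- The inclusion of the free space on `V(G)` into the free space on `α`. -/
noncomputable def vertexInclusion (G : Graph α β) : (V(G) →₀ ℚ) →ₗ[ℚ] (α →₀ ℚ) :=
  Finsupp.lmapDomain ℚ ℚ Subtype.val

@[simp] lemma componentMap_single (a : V(G)) (c : ℚ) : componentMap G (Finsupp.single a c) =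
    Finsupp.single (G.toSimpleGraph.connectedComponentMk a) c :=
  Finsupp.mapDomain_single

@[simp] lemma vertexInclusion_single (a : V(G)) (c : ℚ) :
    vertexInclusion G (Finsupp.single a c) = Finsupp.single (a : α) c :=
  Finsupp.mapDomain_single

lemma vertexInclusion_injective (G : Graph α β) : Function.Injective (vertexInclusion G) :=
  Finsupp.mapDomain_injective Subtype.val_injective

/-- The edge differences span the kernel of the map that adds up the coefficients of the vertices
in each component. -/
lemma map_ker_componentMap (G : Graph α β) :
    (LinearMap.ker (componentMap G)).map (vertexInclusion G) = boundarySpan G E(G) := by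
  apply le_antisymm
  · -- Modulo edge differences, each vertex may be replaced by a representative of its component.
    have key : ∀ x : V(G) →₀ ℚ, vertexInclusion G (x - Finsupp.lmapDomain ℚ ℚ
        (fun c : G.toSimpleGraph.ConnectedComponent => c.out) (componentMap G x)) ∈
          boundarySpan G E(G) := by
      intro x
      induction x using Finsupp.induction_linear with
      | zero => simp
      | add f g hf hg =>
        have := add_mem hf hg
        rw [← map_add] at this
        convert this using 2
        simp only [map_add]
        abel
      | single a c =>
        have h : G.toSimpleGraph.Reachable a (G.toSimpleGraph.connectedComponentMk a).out :=
          (SimpleGraph.ConnectedComponent.exact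
            (Quot.out_eq (G.toSimpleGraph.connectedComponentMk a))).symm
        have := (boundarySpan G E(G)).smul_mem c (single_sub_single_mem_boundarySpan h)
        simpa [Finsupp.mapDomain_single, smul_sub] using this
    rintro _ ⟨x, hx, rfl⟩
    have := key x
    rwa [LinearMap.mem_ker.1 hx, map_zero, sub_zero] at this
  · refine Submodule.span_le.2 ?_
    rintro _ ⟨e, he, u, v, h, rfl⟩
    refine ⟨Finsupp.single ⟨u, h.left_mem⟩ 1 - Finsupp.single ⟨v, h.right_mem⟩ 1, ?_, ?_⟩
    · have : G.toSimpleGraph.connectedComponentMk ⟨u, h.left_mem⟩ =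
          G.toSimpleGraph.connectedComponentMk ⟨v, h.right_mem⟩ := by
        by_cases huv : u = v
        · subst huv; rfl
        · refine SimpleGraph.ConnectedComponent.sound (SimpleGraph.Adj.reachable ⟨?_, e, h⟩)
          simpa using huv
      rw [SetLike.mem_coe, LinearMap.mem_ker, map_sub, componentMap_single, componentMap_single, this, sub_self]
    · rw [map_sub, vertexInclusion_single, vertexInclusion_single]

lemma finite_connectedComponent (hV : V(G).Finite) :
    Finite G.toSimpleGraph.ConnectedComponent :=
  have : Finite V(G) := hV
  Finite.of_surjective _ (Quot.mk_surjective (r := G.toSimpleGraph.Reachable))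

lemma numComponents_pos (hV : V(G).Finite) (hne : V(G).Nonempty) : 0 < numComponents G :=
  have := finite_connectedComponent hV
  have : Nonempty G.toSimpleGraph.ConnectedComponent :=
    hne.to_subtype.map G.toSimpleGraph.connectedComponentMk
  Nat.card_pos

lemma numComponents_add_graphicRank (hV : V(G).Finite) :
    numComponents G + graphicRank G E(G) = V(G).ncard := by
  have : Finite V(G) := hV
  have := finite_connectedComponent hV
  have := Fintype.ofFinite V(G)
  have := Fintype.ofFinite G.toSimpleGraph.ConnectedComponent
  have hsurj : Function.Surjective (componentMap G) :=
    Finsupp.mapDomain_surjective (Quot.mk_surjective (r := G.toSimpleGraph.Reachable))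
  have h := (componentMap G).finrank_range_add_finrank_ker
  rw [LinearMap.range_eq_top.2 hsurj, finrank_top, Module.finrank_finsupp_self,
    Module.finrank_finsupp_self, ← (Submodule.equivMapOfInjective _ (vertexInclusion_injective G)
      _).finrank_eq.symm, map_ker_componentMap] at h
  rwa [numComponents, Nat.card_eq_fintype_card, graphicRank, ← Nat.card_coe_set_eq,
    Nat.card_eq_fintype_card]

end Components
/-! ### Spanning trees as bases of the cycle matroid -/

section Trees

variable {α : Type u} {β : Type v} {G H T : Graph α β}

/-- In a loopless graph, sending an edge to its pair of ends is a surjection onto the edges of the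
underlying simple graph. -/
lemma exists_edge_surjection (G : Graph α β) [G.Loopless] :
    ∃ f : E(G) → G.toSimpleGraph.edgeSet, Function.Surjective f ∧
      ∀ e : E(G), ∀ u v : V(G), (f e : Sym2 V(G)) = s(u, v) ↔ G.IsLink e u v := by
  have h : ∀ e : E(G), ∃ p : G.toSimpleGraph.edgeSet,
      ∀ u v : V(G), (p : Sym2 V(G)) = s(u, v) ↔ G.IsLink e u v := by
    rintro ⟨e, he⟩
    obtain ⟨x, y, hxy⟩ := G.exists_isLink_of_mem_edgeSet he
    refine ⟨⟨s(⟨x, hxy.left_mem⟩, ⟨y, hxy.right_mem⟩), ?_⟩, fun u v => ?_⟩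
    · exact (G.toSimpleGraph_adj_iff _ _).2 hxy.adj
    · rw [hxy.isLink_iff, Sym2.eq_iff]
      simp only [Subtype.ext_iff]
  choose f hf using h
  refine ⟨f, ?_, hf⟩
  rintro ⟨p, hp⟩
  induction p with
  | _ u v =>
    obtain ⟨-, e, he⟩ := hp
    exact ⟨⟨e, he.edge_mem⟩, Subtype.ext ((hf _ _ _).2 he)⟩

lemma numComponents_eq_one_iff : numComponents G = 1 ↔ G.toSimpleGraph.Connected := by
  rw [numComponents, Nat.card_eq_one_iff_unique]
  constructor
  · rintro ⟨h1, ⟨c⟩⟩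
    have := c.out
    exact { preconnected := fun a b => SimpleGraph.ConnectedComponent.exact (Subsingleton.elim _ _)
            nonempty := ⟨this⟩ }
  · intro h
    have := h.nonempty
    exact ⟨h.preconnected.subsingleton_connectedComponent,
      ⟨G.toSimpleGraph.connectedComponentMk this.some⟩⟩

lemma IsSpanningTree.ncard_edgeSet_add_one (hV : V(G).Finite) (hT : IsSpanningTree T G) :
    E(T).ncard + 1 = V(G).ncard := by
  have := hT.simple
  have hVT : V(T) = V(G) := hT.spanning.vertexSet_eq
  have : Finite V(T) := hVT ▸ hV
  obtain ⟨f, hf, hf'⟩ := exists_edge_surjection T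
  have hinj : Function.Injective f := by
    rintro ⟨e, he⟩ e' hee
    obtain ⟨x, y, hxy⟩ := T.exists_isLink_of_mem_edgeSet he
    have h1 := (hf' ⟨e, he⟩ ⟨x, hxy.left_mem⟩ ⟨y, hxy.right_mem⟩).2 hxy
    rw [hee, hf'] at h1
    exact Subtype.ext (hxy.eq h1)
  rw [← Nat.card_coe_set_eq, Nat.card_congr (Equiv.ofBijective f ⟨hinj, hf⟩), ← hVT,
    ← Nat.card_coe_set_eq]
  exact (SimpleGraph.isTree_iff_connected_and_card.1 hT.isTree).2

lemma IsSpanningTree.graphicRank_eq (hV : V(G).Finite) (hT : IsSpanningTree T G) :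
    graphicRank G E(T) = E(T).ncard := by
  have hVT : V(T) = V(G) := hT.spanning.vertexSet_eq
  have h1 := numComponents_add_graphicRank (G := T) (hVT ▸ hV)
  have h2 := hT.ncard_edgeSet_add_one hV
  rw [numComponents_eq_one_iff.2 hT.isTree.connected, hVT,
    graphicRank_eq_of_le hT.spanning.le subset_rfl] at h1
  omega

/-- An independent set of `|V(G)| - 1` edges is the edge set of a spanning tree. -/
lemma isSpanningTree_restrict (hG : IsFiniteLoopless G) {I : Set β} (hI : I ⊆ E(G))
    (hr : graphicRank G I = I.ncard) (hcard : I.ncard + 1 = V(G).ncard) :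
    IsSpanningTree (G.restrict I) G := by
  have hE : E(G.restrict I) = I := Set.inter_eq_right.2 hI
  have hV : V(G.restrict I) = V(G) := rfl
  have := hG.loopless
  have : (G.restrict I).Loopless := Graph.Loopless.anti Graph.restrict_le
  have : Finite V(G.restrict I) := hG.finite_vertexSet
  have : Finite E(G.restrict I) := by
    rw [hE]; exact hG.finite_edgeSet.subset hI
  have hconn : (G.restrict I).toSimpleGraph.Connected := by
    rw [← numComponents_eq_one_iff]
    have := numComponents_add_graphicRank (G := G.restrict I) hG.finite_vertexSet
    rw [graphicRank_eq_of_le Graph.restrict_le subset_rfl, hE, hV] at this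
    omega
  obtain ⟨f, hf, hf'⟩ := exists_edge_surjection (G.restrict I)
  have h1 := hconn.card_vert_le_card_edgeSet_add_one
  have h2 := Nat.card_le_card_of_surjective f hf
  have h3 : Nat.card E(G.restrict I) = I.ncard := by rw [Nat.card_coe_set_eq, hE]
  have h4 : Nat.card V(G.restrict I) = V(G).ncard := Nat.card_coe_set_eq _
  have hbij : Function.Bijective f := hf.bijective_of_nat_card_le (by omega)
  refine ⟨⟨Graph.restrict_le, hV⟩, { eq_of_isLink := ?_ }, ?_⟩
  · intro e e' x y he he'
    have h5 := (hf' ⟨e, he.edge_mem⟩ ⟨x, he.left_mem⟩ ⟨y, he.right_mem⟩).2 he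
    have h6 := (hf' ⟨e', he'.edge_mem⟩ ⟨x, he.left_mem⟩ ⟨y, he.right_mem⟩).2 he'
    exact congrArg Subtype.val (hbij.1 (Subtype.ext (h5.trans h6.symm)))
  · exact SimpleGraph.isTree_iff_connected_and_card.2 ⟨hconn, by omega⟩

end Trees

/-! ### Edge-disjoint spanning trees and edge-cuts -/

section Packing

variable {α : Type u} {β : Type v} {G : Graph α β} {k m : ℕ}

lemma numComponents_deleteEdges_add (hV : V(G).Finite) (Y : Set β) :
    numComponents (G.deleteEdges Y) + graphicRank G (E(G) \ Y) = V(G).ncard := by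
  have h := numComponents_add_graphicRank (G := G.deleteEdges Y) hV
  rwa [graphicRank_eq_of_le Graph.deleteEdges_le subset_rfl] at h

lemma HasDisjointSpanningTrees.mono (h : HasDisjointSpanningTrees G k) (hmk : m ≤ k) :
    HasDisjointSpanningTrees G m := by
  obtain ⟨T, hT, hd⟩ := h
  exact ⟨fun i => T (i.castLE hmk), fun i => hT _,
    fun i j hij => hd ((Fin.castLE_injective hmk).ne hij)⟩

lemma ncard_iUnion_edgeSet (hG : IsFiniteLoopless G) {T : Fin m → Graph α β}
    (hT : ∀ i, IsSpanningTree (T i) G) (hd : Pairwise fun i j => Disjoint E(T i) E(T j)) :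
    (⋃ i, E(T i)).ncard = m * (V(G).ncard - 1) := by
  have hfin : ∀ i, E(T i).Finite := fun i =>
    hG.finite_edgeSet.subset (hT i).spanning.le.edgeSet_mono
  have h : ∀ i, E(T i).ncard = V(G).ncard - 1 := fun i => by
    have := (hT i).ncard_edgeSet_add_one hG.finite_vertexSet
    omega
  rw [Set.ncard_iUnion_of_finite hfin hd, finsum_eq_sum_of_fintype]
  simp [h]

lemma mul_le_ncard_edgeSet (hG : IsFiniteLoopless G) (h : HasDisjointSpanningTrees G m) :
    m * (V(G).ncard - 1) ≤ E(G).ncard := by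
  obtain ⟨T, hT, hd⟩ := h
  rw [← ncard_iUnion_edgeSet hG hT hd]
  exact Set.ncard_le_ncard (Set.iUnion_subset fun i => (hT i).spanning.le.edgeSet_mono)
    hG.finite_edgeSet

/-- A set of edges whose deletion disconnects `G` meets each of the disjoint spanning trees. -/
lemma le_encard_of_one_lt_numComponents (hV : V(G).Finite) (h : HasDisjointSpanningTrees G m)
    {Y : Set β} (hY : 1 < numComponents (G.deleteEdges Y)) : (m : ℕ∞) ≤ Y.encard := by
  obtain ⟨T, hT, hd⟩ := h
  have hmeet : ∀ i, ∃ e ∈ Y, e ∈ E(T i) := by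
    intro i
    by_contra! hcon
    have h1 : E(T i) ⊆ E(G) \ Y := fun e he =>
      ⟨(hT i).spanning.le.edgeSet_mono he, fun heY => hcon e heY he⟩
    have h2 := graphicRank_mono hV h1
    have h3 := numComponents_deleteEdges_add hV Y
    have h4 := (hT i).graphicRank_eq hV
    have h5 := (hT i).ncard_edgeSet_add_one hV
    omega
  choose f hfY hfT using hmeet
  have hinj : Function.Injective f := fun i j hij => by
    by_contra hne
    exact Set.disjoint_left.1 (hd hne) (hfT i) (hij ▸ hfT j)
  calc (m : ℕ∞) = (Set.range f).encard := by
        rw [← Set.image_univ, hinj.encard_image]; simp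
    _ ≤ Y.encard := Set.encard_le_encard (Set.range_subset_iff.2 hfY)

lemma hasDisjointSpanningTrees_of_treePackingNumber_eq (hk : 0 < k)
    (h : treePackingNumber G = k) : HasDisjointSpanningTrees G k := by
  by_contra hcon
  have : treePackingNumber G ≤ ((k - 1 : ℕ) : ℕ∞) := by
    refine iSup₂_le fun m hm => ?_
    have : ¬ k ≤ m := fun hkm => hcon (hm.mono hkm)
    exact_mod_cast (by omega : m ≤ k - 1)
  rw [h] at this
  have : k ≤ k - 1 := by exact_mod_cast this
  omega

lemma exists_isEdgeCut_of_edgeConnectivity_eq (h : edgeConnectivity G = k) :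
    ∃ X, IsEdgeCut G X ∧ X.encard = k := by
  have h1 : edgeConnectivity G < ((k + 1 : ℕ) : ℕ∞) := by
    rw [h]; exact_mod_cast Nat.lt_succ_self k
  simp only [edgeConnectivity, iInf_lt_iff] at h1
  obtain ⟨X, hX, hlt⟩ := h1
  refine ⟨X, hX, le_antisymm ?_ (h ▸ iInf₂_le X hX)⟩
  push_cast at hlt
  exact Order.le_of_lt_add_one hlt

lemma edgeConnectivity_le_encard {Y : Set β} (hfin : Y.Finite) (hYE : Y ⊆ E(G))
    (hY : 1 < numComponents (G.deleteEdges Y)) : edgeConnectivity G ≤ Y.encard := by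
  obtain ⟨X, hXY, hX⟩ := (hfin.finite_subsets.subset
    (fun Z hZ => hZ.1 : {Z | Z ⊆ Y ∧ 1 < numComponents (G.deleteEdges Z)} ⊆ _)).exists_le_minimal
    ⟨subset_rfl, hY⟩
  refine (iInf₂_le X ⟨⟨hXY.trans hYE, hX.1.2⟩, fun Z hZ hZX => ?_⟩).trans
    (Set.encard_le_encard hXY)
  exact hX.2 ⟨hZX.trans hXY, hZ.2⟩ hZX

/-- Criterion for `κ'(G) = τ(G) = k` for a graph with the least number of edges that `k` disjoint
spanning trees need. -/
lemma connectivity_eq_of_hasDisjointSpanningTrees (hG : IsFiniteLoopless G)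
    (hn : 1 < V(G).ncard) (hT : HasDisjointSpanningTrees G k)
    (hE : E(G).ncard = k * (V(G).ncard - 1)) {Y : Set β} (hYE : Y ⊆ E(G)) (hYk : Y.encard ≤ k)
    (hY : 1 < numComponents (G.deleteEdges Y)) :
    edgeConnectivity G = k ∧ treePackingNumber G = k := by
  refine ⟨le_antisymm ?_ ?_, le_antisymm ?_ ?_⟩
  · exact (edgeConnectivity_le_encard (hG.finite_edgeSet.subset hYE) hYE hY).trans hYk
  · exact le_iInf₂ fun X hX => le_encard_of_one_lt_numComponents hG.finite_vertexSet hT hX.1.2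
  · refine iSup₂_le fun m hm => ?_
    have := mul_le_ncard_edgeSet hG hm
    rw [hE] at this
    exact_mod_cast Nat.le_of_mul_le_mul_right this (by omega)
  · exact le_iSup₂_of_le k hT le_rfl

/-- The union of `k` disjoint spanning trees of a graph with edge connectivity `k` competes in the
definition of the extremal family, so that a member of the family has only the edges of these
trees. -/
lemma MemFamilyOfOrder.ncard_edgeSet {n : ℕ} (hn : 1 < n) (hk : 0 < k)
    (h : MemFamilyOfOrder k n G) : E(G).ncard = k * (n - 1) := by
  have hG := h.isFiniteLoopless
  have hV := hG.finite_vertexSet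
  have htrees := hasDisjointSpanningTrees_of_treePackingNumber_eq hk h.treePackingNumber_eq
  refine le_antisymm ?_ (h.card_vertexSet ▸ mul_le_ncard_edgeSet hG htrees)
  obtain ⟨T, hT, hd⟩ := htrees
  obtain ⟨X, hX, hXk⟩ := exists_isEdgeCut_of_edgeConnectivity_eq h.edgeConnectivity_eq
  have hsub : ⋃ i, E(T i) ⊆ E(G) := Set.iUnion_subset fun i => (hT i).spanning.le.edgeSet_mono
  set U := ⋃ i, E(T i) with hU
  have hE : E(G.restrict U) = U := Set.inter_eq_right.2 hsub
  have hVU : V(G.restrict U) = V(G) := rfl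
  have hle : G.restrict U ≤ G := Graph.restrict_le
  have := hG.loopless
  have hGU : IsFiniteLoopless (G.restrict U) :=
    ⟨hV, by rw [hE]; exact hG.finite_edgeSet.subset hsub, Graph.Loopless.anti hle⟩
  have hTU : HasDisjointSpanningTrees (G.restrict U) k := by
    refine ⟨T, fun i => ⟨⟨?_, (hT i).spanning.vertexSet_eq⟩, (hT i).simple, (hT i).isTree⟩, hd⟩
    refine (Graph.Compatible.of_le_le (hT i).spanning.le hle).le_iff.2 ⟨?_, ?_⟩
    · exact (hT i).spanning.vertexSet_eq.le
    · rw [hE]; exact Set.subset_iUnion (fun i => E(T i)) i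
  have hcard : E(G.restrict U).ncard = k * (V(G.restrict U).ncard - 1) := by
    rw [hE, hVU, ncard_iUnion_edgeSet hG hT hd]
  have hcut : 1 < numComponents ((G.restrict U).deleteEdges (X ∩ E(G.restrict U))) := by
    have h1 := numComponents_deleteEdges_add (G := G.restrict U) hV (X ∩ E(G.restrict U))
    have h2 := numComponents_deleteEdges_add hV X
    have h3 := hX.1.2
    have h4 : E(G.restrict U) \ (X ∩ E(G.restrict U)) ⊆ E(G) \ X := fun e he =>
      ⟨hle.edgeSet_mono he.1, fun heX => he.2 ⟨heX, he.1⟩⟩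
    have h5 := graphicRank_mono hV h4
    rw [graphicRank_eq_of_le hle Set.sdiff_subset, hVU] at h1
    omega
  obtain ⟨h1, h2⟩ := connectivity_eq_of_hasDisjointSpanningTrees hGU
    (by rw [hVU, h.card_vertexSet]; exact hn) hTU hcard Set.inter_subset_right
    ((Set.encard_le_encard Set.inter_subset_left).trans hXk.le) hcut
  have := h.minimal α β _ hGU h.card_vertexSet h1 h2
  rwa [hcard, hVU, h.card_vertexSet] at this

end Packing

/-! ### Densities -/

section Density

variable {α : Type u} {β : Type v} {G H : Graph α β} {k : ℕ}

lemma ncard_sub_numComponents (hV : V(G).Finite) :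
    (V(G).ncard : ℝ) - numComponents G = graphicRank G E(G) := by
  rw [← numComponents_add_graphicRank hV]
  push_cast
  ring

/-- If `E(G)` is covered by `k` spanning trees, then each set `X` of edges is covered by `k`
independent sets, the intersections of `X` with the trees. -/
lemma ncard_le_mul_graphicRank (hG : IsFiniteLoopless G) {T : Fin k → Graph α β}
    (hT : ∀ i, IsSpanningTree (T i) G) (hcov : ⋃ i, E(T i) = E(G)) {X : Set β} (hX : X ⊆ E(G)) :
    X.ncard ≤ k * graphicRank G X := by
  have hV := hG.finite_vertexSet
  have h1 : X = ⋃ i, X ∩ E(T i) := by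
    rw [← Set.inter_iUnion, hcov, Set.inter_eq_left.2 hX]
  calc X.ncard = (⋃ i, X ∩ E(T i)).ncard := by rw [← h1]
    _ ≤ ∑ i, (X ∩ E(T i)).ncard := Set.ncard_iUnion_le_of_fintype _
    _ ≤ ∑ _i : Fin k, graphicRank G X := Finset.sum_le_sum fun i _ => by
        rw [← graphicRank_eq_ncard_of_subset hV
          (hG.finite_edgeSet.subset (hT i).spanning.le.edgeSet_mono) Set.inter_subset_right
          ((hT i).graphicRank_eq hV)]
        exact graphicRank_mono hV Set.inter_subset_left
    _ = k * graphicRank G X := by simp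

lemma bddAbove_density (hG : IsFiniteLoopless G) :
    BddAbove {q : ℝ | ∃ H : Graph α β, H ≤ G ∧ (V(H).ncard : ℝ) - (numComponents H : ℝ) ≠ 0 ∧
      q = density H} := by
  refine ⟨E(G).ncard, ?_⟩
  rintro _ ⟨H, hH, h0, rfl⟩
  rw [density]
  rw [ncard_sub_numComponents (hG.finite_vertexSet.subset hH.vertexSet_mono)] at h0 ⊢
  have h1 : (1 : ℝ) ≤ graphicRank H E(H) := by
    exact_mod_cast Nat.one_le_iff_ne_zero.2 (by exact_mod_cast h0)
  have h2 : (E(H).ncard : ℝ) ≤ E(G).ncard := by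
    exact_mod_cast Set.ncard_le_ncard hH.edgeSet_mono hG.finite_edgeSet
  exact (div_le_self (Nat.cast_nonneg _) h1).trans h2

/-- If no subgraph has density above `k`, then `|X| ≤ k r(X)` for every set `X` of edges: compare
with the spanning subgraph with edge set `X`. The denominator of its density is nonzero when `X` is
nonempty, as there are no loops. -/
lemma ncard_le_mul_graphicRank_of_maxSubgraphDensity_le (hG : IsFiniteLoopless G)
    (h : maxSubgraphDensity G ≤ k) {X : Set β} (hX : X ⊆ E(G)) :
    X.ncard ≤ k * graphicRank G X := by
  have hV := hG.finite_vertexSet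
  have := hG.loopless
  obtain rfl | ⟨e, he⟩ := X.eq_empty_or_nonempty
  · simp
  have hE : E(G.restrict X) = X := Set.inter_eq_right.2 hX
  have hr : graphicRank (G.restrict X) E(G.restrict X) = graphicRank G X := by
    rw [graphicRank_eq_of_le Graph.restrict_le subset_rfl, hE]
  have hpos : 0 < graphicRank G X := by
    refine Nat.pos_of_ne_zero fun h0 => ?_
    have := finiteDimensional_boundarySpan hV X
    obtain ⟨u, v, huv⟩ := G.exists_isLink_of_mem_edgeSet (hX he)
    have hmem : (Finsupp.single u 1 - Finsupp.single v 1 : α →₀ ℚ) ∈ boundarySpan G X :=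
      Submodule.subset_span ⟨e, he, u, v, huv, rfl⟩
    rw [Submodule.finrank_eq_zero.1 h0, Submodule.mem_bot, sub_eq_zero] at hmem
    exact huv.ne (Finsupp.single_left_injective one_ne_zero hmem)
  have hd : density (G.restrict X) ≤ k := by
    refine le_trans (le_csSup (bddAbove_density hG) ⟨_, Graph.restrict_le, ?_, rfl⟩) h
    rw [ncard_sub_numComponents (G := G.restrict X) hV, hr]
    exact_mod_cast hpos.ne'
  rw [density, ncard_sub_numComponents (G := G.restrict X) hV, hr, hE,
    div_le_iff₀ (by exact_mod_cast hpos)] at hd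
  exact_mod_cast hd

/-- The case of the Nash-Williams theorem in which the forests have to be spanning trees: if
`|X| ≤ k r(X)` for all sets `X` of edges of a connected graph with `k (|V(G)| - 1)` edges, then the
`k` independent sets of the covering theorem have `|V(G)| - 1` elements each. -/
lemma hasDisjointSpanningTrees_of_ncard_le (hG : IsFiniteLoopless G)
    (hconn : numComponents G = 1) (hE : E(G).ncard = k * (V(G).ncard - 1))
    (h : ∀ X ⊆ E(G), X.ncard ≤ k * graphicRank G X) : HasDisjointSpanningTrees G k := by
  classical
  have hV := hG.finite_vertexSet
  obtain ⟨I, hd, hc, hI⟩ := exists_disjoint_independent_cover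
    (fun (_ : Fin k) (X : Finset β) => (graphicRank G X : ℤ))
    (fun _ => isRankFunction_graphicRank hV) hG.finite_edgeSet.toFinset fun X hX => by
      have := h X (by simpa using hX)
      rw [Set.ncard_coe_finset] at this
      simpa using (by exact_mod_cast this : (X.card : ℤ) ≤ k * graphicRank G X)
  have hsub : ∀ i, (I i : Set β) ⊆ E(G) := fun i => by
    have := hc ▸ Finset.subset_biUnion_of_mem I (Finset.mem_univ i)
    simpa using this
  have hrank := numComponents_add_graphicRank hV
  have hle : ∀ i, (I i).card ≤ V(G).ncard - 1 := fun i => by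
    have h1 := graphicRank_mono hV (hsub i)
    have h2 : graphicRank G (I i) = (I i).card := by exact_mod_cast hI i
    omega
  have hsum : ∑ i, (I i).card = ∑ _i : Fin k, (V(G).ncard - 1) := by
    rw [← Finset.card_biUnion fun i _ j _ hij => hd hij, hc,
      ← Set.ncard_eq_toFinset_card _ hG.finite_edgeSet, hE]
    simp
  have heq : ∀ i, (I i).card = V(G).ncard - 1 := fun i =>
    (Finset.sum_eq_sum_iff_of_le fun i _ => hle i).1 hsum i (Finset.mem_univ i)
  refine ⟨fun i => G.restrict (I i), fun i => isSpanningTree_restrict hG (hsub i) ?_ ?_, ?_⟩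
  · rw [Set.ncard_coe_finset]
    exact_mod_cast hI i
  · rw [Set.ncard_coe_finset, heq i]
    omega
  · intro i j hij
    have := Finset.disjoint_coe.2 (hd hij)
    exact this.mono Set.inter_subset_right Set.inter_subset_right

end Density

end Multigraph

theorem mainTheorem3 {α : Type u} {β : Type v} (G : Graph α β)
    (hG : Multigraph.IsFiniteLoopless G) (k : ℕ) (hk : 0 < k) :
    Multigraph.MemFamily k G ↔
      (∃ X : Set β, Multigraph.IsEdgeCut G X ∧ X.ncard = k) ∧
        (Multigraph.IsUniformlyDense G ∧ Multigraph.density G = (k : ℝ)) := by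
  open Multigraph in
  have hV := hG.finite_vertexSet
  have hrank := numComponents_add_graphicRank hV
  constructor
  · rintro ⟨n, hn, h⟩
    have hE := h.ncard_edgeSet hn hk
    have hcard := h.card_vertexSet
    obtain ⟨X, hX, hXk⟩ := exists_isEdgeCut_of_edgeConnectivity_eq h.edgeConnectivity_eq
    obtain ⟨T, hT, hd⟩ :=
      hasDisjointSpanningTrees_of_treePackingNumber_eq hk h.treePackingNumber_eq
    have hcov : ⋃ i, E(T i) = E(G) := by
      refine Set.eq_of_subset_of_ncard_le
        (Set.iUnion_subset fun i => (hT i).spanning.le.edgeSet_mono) ?_ hG.finite_edgeSet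
      rw [hE, ncard_iUnion_edgeSet hG hT hd, hcard]
    have hr : graphicRank G E(G) = n - 1 := by
      have h0 := (hT ⟨0, hk⟩).graphicRank_eq hV
      have h1 := (hT ⟨0, hk⟩).ncard_edgeSet_add_one hV
      have h2 := graphicRank_mono hV (hT ⟨0, hk⟩).spanning.le.edgeSet_mono
      have h3 := numComponents_pos hV (Set.nonempty_of_ncard_ne_zero (by omega))
      omega
    have hr0 : (graphicRank G E(G) : ℝ) ≠ 0 := by
      exact_mod_cast (by omega : graphicRank G E(G) ≠ 0)
    have hdens : density G = k := by
      rw [density, ncard_sub_numComponents hV, div_eq_iff hr0, hE, hr]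
      push_cast
      rfl
    refine ⟨⟨X, hX, by rw [Set.ncard, hXk]; rfl⟩, ?_, hdens⟩
    refine (IsGreatest.csSup_eq (And.intro ?_ ?_)).symm
    · exact ⟨G, le_rfl, by rwa [ncard_sub_numComponents hV], rfl⟩
    · rintro _ ⟨H, hH, h0, rfl⟩
      rw [hdens, density]
      rw [ncard_sub_numComponents (hV.subset hH.vertexSet_mono)] at h0 ⊢
      rw [div_le_iff₀ (lt_of_le_of_ne (Nat.cast_nonneg _) h0.symm),
        graphicRank_eq_of_le hH subset_rfl]
      exact_mod_cast ncard_le_mul_graphicRank hG hT hcov hH.edgeSet_mono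
  · rintro ⟨⟨X, hX, hXk⟩, hunif, hdens⟩
    have hXfin : X.Finite := hG.finite_edgeSet.subset hX.1.1
    have hXk' : X.encard = k := by rw [← hXfin.cast_ncard_eq, hXk]
    have hcut := numComponents_deleteEdges_add hV X
    have hX1 := hX.1.2
    -- A disconnected graph has only the empty edge-cut, and `k` is positive.
    have hle : numComponents G ≤ 1 := by
      by_contra! hlt
      have : X ⊆ ∅ := hX.2 ⟨Set.empty_subset _, by rwa [Graph.deleteEdges_empty]⟩
        (Set.empty_subset _)
      rw [Set.subset_empty_iff.1 this, Set.ncard_empty] at hXk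
      omega
    have hn : 1 < V(G).ncard := by omega
    have hconn : numComponents G = 1 := by
      have := numComponents_pos hV (Set.nonempty_of_ncard_ne_zero (by omega))
      omega
    have hE : E(G).ncard = k * (V(G).ncard - 1) := by
      have hr : graphicRank G E(G) = V(G).ncard - 1 := by omega
      have hr0 : (graphicRank G E(G) : ℝ) ≠ 0 := by
        exact_mod_cast (by omega : graphicRank G E(G) ≠ 0)
      rw [density, ncard_sub_numComponents hV, div_eq_iff hr0, hr] at hdens
      exact_mod_cast hdens
    have hT : HasDisjointSpanningTrees G k := hasDisjointSpanningTrees_of_ncard_le hG hconn hE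
      fun Y hY => ncard_le_mul_graphicRank_of_maxSubgraphDensity_le hG
        (by rw [← hunif, hdens]) hY
    obtain ⟨h1, h2⟩ :=
      connectivity_eq_of_hasDisjointSpanningTrees hG hn hT hE hX.1.1 hXk'.le hX1
    refine ⟨V(G).ncard, hn, hG, rfl, h1, h2, fun α' β' H hH hHn _ hHt => ?_⟩
    rw [hE, ← hHn]
    exact mul_le_ncard_edgeSet hH (hasDisjointSpanningTrees_of_treePackingNumber_eq hk hHt)
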